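/- Let $R$ be a commutative Noetherian Cohen-Macaulay local ring with residue field $k$ and Krull dimension $d$, and let $\omega_R$ be a canonical module of $R$ (a maximal Cohen-Macaulay module of finite injective dimension with $\dim_k \mathrm{Ext}^d_R(k,\omega_R)=1$; the zero module counts as maximal Cohen-Macaulay). Let $\Lambda$ be a semiperfect $R$-order, i.e. a module-finite $R$-algebra that is maximal Cohen-Macaulay as an $R$-module, and put $\omega=\mathrm{Hom}_R(\Lambda,\omega_R)$. All $\Lambda$-modules are on one fixed side, say left modules (right $\Lambda$-modules are left modules over $\Lambda^{\mathrm{op}}$, which is again a semiperfect $R$-order). For a module $M$, $\mathrm{add}\,M$ denotes the class of direct summands of the finite direct sums $M^n$. A CM-injective coresolution of $\Lambda$ is an exact sequence $0\to\Lambda\to I^0\to I^1\to\cdots$ of $\Lambda$-modules with all $I^j\in\mathrm{add}\,\omega$ (possibly zero from some point on); it is minimal if each of its maps $f\colon X\to I^j$ (with source $X=\Lambda$ or $X=I^{j-1}$) is left minimal, i.e. every endomorphism $\varphi$ of $I^j$ with $\varphi f=f$ is an automorphism. The CM-dominant dimension of $\Lambda$ is the smallest $\ell$ such that the term $I^\ell$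 of the minimal CM-injective coresolution of $\Lambda$ is not projective ($\infty$ if there is none), and $\Lambda$ is called a QF-3 order if its CM-dominant dimension is at least $1$. Let $\Pi$ be a $\Lambda$-module with $\mathrm{add}\,\Pi=\mathrm{add}\,\Lambda\cap\mathrm{add}\,\omega$. Suppose that $\Lambda$ is a QF-3 order. Then there is a CM-injective coresolution $0\to\Lambda\xrightarrow{\,i\,}\Pi^0\to I^1\to I^2\to\cdots$ of $\Lambda$ with $\Pi^0\in\mathrm{add}\,\Pi$. Moreover, for every such coresolution, with $K=\mathrm{coker}(i)$, the module $T=K\oplus\Pi$ is a tilting $\Lambda$-module, that is, $T$ is finitely generated and 1. the projective dimension of $T$ is at most $1$; 2. there is an exact sequence $0\to\Lambda\to t_0\to t_1\to 0$ with $t_0,t_1\in\mathrm{add}\,T$; 3. $\mathrm{Ext}^i_\Lambda(T,T)=0$ for all $i>0$. -/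

import Mathlib

open CategoryTheory

universe u

/-- The depth of `M` over a local ring `R`: the supremum of the lengths of the sequences
`r₁, …, r_ℓ` in the maximal ideal such that each `r_j` is a non-zerodivisor on
`M / (r₁, …, r_{j-1}) M`. -/
noncomputable def moduleDepth (R : Type u) [CommRing R] [IsLocalRing R]
    (M : Type u) [AddCommGroup M] [Module R M] : ℕ∞ :=
  ⨆ (rs : List R) (_ : (∀ r ∈ rs, r ∈ IsLocalRing.maximalIdeal R) ∧
    RingTheory.Sequence.IsWeaklyRegular M rs), (rs.length : ℕ∞)

/-- The dimension of a module: the Krull dimension of `R / ann M`. -/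
noncomputable def moduleDim (R : Type u) [CommRing R]
    (M : Type u) [AddCommGroup M] [Module R M] : WithBot ℕ∞ :=
  ringKrullDim (R ⧸ Module.annihilator R M)

/-- (Finitely generated) maximal Cohen-Macaulay modules: `M = 0`, or `depth M = dim M = dim R`. -/
structure IsMCM (R : Type u) [CommRing R] [IsLocalRing R]
    (M : Type u) [AddCommGroup M] [Module R M] : Prop where
  finite : Module.Finite R M
  depth_eq : Subsingleton M ∨
    ((moduleDepth R M : WithBot ℕ∞) = moduleDim R M ∧ moduleDim R M = ringKrullDim R)

/-- `W` is a canonical module of the Cohen-Macaulay local ring `R`, with residue field `k`: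
it is maximal Cohen-Macaulay, it has finite injective dimension, and
`Ext_R^d(k, W)` is one-dimensional over `k`, where `d = dim R`. -/
structure IsCanonicalModule (R : Type u) [CommRing R] [IsLocalRing R]
    (W : Type u) [AddCommGroup W] [Module R W] : Prop where
  isMCM : IsMCM R W
  finite_injectiveDimension : ∃ n : ℕ, HasInjectiveDimensionLE (ModuleCat.of R W) n
  ext_residueField : ∃ d : ℕ, ringKrullDim R = d ∧
    Nonempty (Abelian.Ext (ModuleCat.of R (IsLocalRing.ResidueField R)) (ModuleCat.of R W) d
      ≃ₗ[R] IsLocalRing.ResidueField R)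

/-- A ring is semiperfect if it is semisimple modulo its Jacobson radical `J` and idempotents lift
modulo `J`. -/
structure IsSemiperfect (A : Type u) [Ring A] : Prop where
  semisimple : IsSemisimpleRing (A ⧸ Ring.jacobson A)
  lift : ∀ e : A ⧸ Ring.jacobson A, IsIdempotentElem e →
    ∃ f : A, IsIdempotentElem f ∧ Ideal.Quotient.mk (Ring.jacobson A) f = e

/-- `X ∈ add M`: the module `X` is a direct summand of `Mⁿ` for some `n`. -/
def InAdd (A : Type u) [Ring A] (M : Type u) [AddCommGroup M] [Module A M]
    (X : Type u) [AddCommGroup X] [Module A X] : Prop :=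
  ∃ (n : ℕ) (s : X →ₗ[A] (Fin n → M)) (r : (Fin n → M) →ₗ[A] X), r ∘ₗ s = LinearMap.id

/-- The canonical module `ω = Hom_R(A, W)` of an `R`-order `A`. -/
def OrderCanonical (R A W : Type u) [CommRing R] [Ring A] [Algebra R A]
    [AddCommGroup W] [Module R W] : Type u :=
  A →ₗ[R] W

namespace OrderCanonical

variable (R A W : Type u) [CommRing R] [Ring A] [Algebra R A] [AddCommGroup W] [Module R W]

noncomputable instance : AddCommGroup (OrderCanonical R A W) :=
  inferInstanceAs (AddCommGroup (A →ₗ[R] W))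

/-- The `A`-module structure on `Hom_R(A, W)`: `(a • f) x = f (x * a)`. -/
noncomputable instance : Module A (OrderCanonical R A W) where
  smul a f := LinearMap.comp (show A →ₗ[R] W from f) (LinearMap.mulRight R a)
  one_smul f := LinearMap.ext fun x => congrArg (show A →ₗ[R] W from f) (mul_one x)
  mul_smul a b f :=
    LinearMap.ext fun x => congrArg (show A →ₗ[R] W from f) (mul_assoc x a b).symm
  smul_zero _ := LinearMap.ext fun _ => rfl
  smul_add _ _ _ := LinearMap.ext fun _ => rfl
  add_smul a b f := LinearMap.ext fun x =>
    (congrArg (show A →ₗ[R] W from f) (mul_add x a b)).trans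
      (map_add (show A →ₗ[R] W from f) (x * a) (x * b))
  zero_smul f := LinearMap.ext fun x =>
    (congrArg (show A →ₗ[R] W from f) (mul_zero x)).trans (map_zero (show A →ₗ[R] W from f))

end OrderCanonical

/-- A CM-injective coresolution of the `A`-module `M`: an exact sequence
`0 → M → I⁰ → I¹ → I² → ⋯` with all terms `Iʲ` in `add ω` (a finite coresolution is continued
by zero modules). -/
structure CMInjCoresolution (R A W : Type u) [CommRing R] [Ring A] [Algebra R A]
    [AddCommGroup W] [Module R W] (M : Type u) [AddCommGroup M] [Module A M] where
  I : ℕ → Type u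
  [addCommGroup : ∀ j, AddCommGroup (I j)]
  [module : ∀ j, Module A (I j)]
  ι : M →ₗ[A] I 0
  d : ∀ j, I j →ₗ[A] I (j + 1)
  inAdd : ∀ j, InAdd A (OrderCanonical R A W) (I j)
  injective : Function.Injective ι
  exact_zero : Function.Exact ι (d 0)
  exact_succ : ∀ j, Function.Exact (d j) (d (j + 1))

attribute [instance] CMInjCoresolution.addCommGroup CMInjCoresolution.module

/-- A homomorphism `f : M → I` is left minimal if every endomorphism `φ` of `I` with
`φ ∘ f = f` is an automorphism. -/
def IsLeftMinimal {A : Type u} [Ring A] {M I : Type u} [AddCommGroup M] [Module A M]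
    [AddCommGroup I] [Module A I] (f : M →ₗ[A] I) : Prop :=
  ∀ φ : I →ₗ[A] I, φ ∘ₗ f = f → Function.Bijective φ

namespace CMInjCoresolution

variable {R A W : Type u} [CommRing R] [Ring A] [Algebra R A]
    [AddCommGroup W] [Module R W] {M : Type u} [AddCommGroup M] [Module A M]

/-- A CM-injective coresolution is minimal if all its maps are left minimal. -/
def IsMinimal (c : CMInjCoresolution R A W M) : Prop :=
  IsLeftMinimal c.ι ∧ ∀ j, IsLeftMinimal (c.d j)

/-- The smallest `ℓ` such that `I^ℓ` is not projective, or `∞` if there is no such `ℓ`. -/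
noncomputable def firstNonprojective (c : CMInjCoresolution R A W M) : ℕ∞ :=
  ⨅ (l : ℕ) (_ : ¬ Module.Projective A (c.I l)), (l : ℕ∞)

end CMInjCoresolution

/-- The CM-dominant dimension of the order `A`: the smallest `ℓ` such that the term `I^ℓ` of a
minimal CM-injective coresolution of the regular module is not projective. Minimal
coresolutions are unique up to isomorphism, so the supremum below is over equal values. -/
noncomputable def cmDomDim (R A W : Type u) [CommRing R] [Ring A] [Algebra R A]
    [AddCommGroup W] [Module R W] : ℕ∞ :=
  ⨆ (c : CMInjCoresolution R A W A) (_ : c.IsMinimal), c.firstNonprojective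

/-- `A` is a QF-3 order: its CM-dominant dimension is at least one. -/
def IsQF3 (R A W : Type u) [CommRing R] [Ring A] [Algebra R A]
    [AddCommGroup W] [Module R W] : Prop :=
  1 ≤ cmDomDim R A W

/-- `P` is an additive generator of the CM-projective-injective modules:
`add P = add A ∩ add ω`. -/
def IsCMProjInjGenerator (R A W : Type u) [CommRing R] [Ring A] [Algebra R A]
    [AddCommGroup W] [Module R W] (P : Type u) [AddCommGroup P] [Module A P] : Prop :=
  ∀ (X : Type u) [AddCommGroup X] [Module A X],
    InAdd A P X ↔ InAdd A A X ∧ InAdd A (OrderCanonical R A W) X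

/-- A finitely generated `A`-module `T` is a tilting module if its projective dimension is at
most one, there is an exact sequence `0 → A → t₀ → t₁ → 0` with `t₀, t₁ ∈ add T`, and
`Ext_A^i(T, T) = 0` for all `i > 0`. -/
structure IsTilting (A : Type u) [Ring A] (T : Type u) [AddCommGroup T] [Module A T] : Prop where
  finite : Module.Finite A T
  projectiveDimension_le_one : HasProjectiveDimensionLE (ModuleCat.of A T) 1
  coresolution : ∃ (t₀ t₁ : Type u) (_ : AddCommGroup t₀) (_ : Module A t₀)
    (_ : AddCommGroup t₁) (_ : Module A t₁) (f : A →ₗ[A] t₀) (g : t₀ →ₗ[A] t₁),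
    InAdd A T t₀ ∧ InAdd A T t₁ ∧
      Function.Injective f ∧ Function.Exact f g ∧ Function.Surjective g
  ext_self : ∀ i : ℕ, 0 < i → Subsingleton (Abelian.Ext (ModuleCat.of A T) (ModuleCat.of A T) i)

section ExtModules

variable {A : Type u} [Ring A]
  {N₁ N₂ N₃ : Type u} [AddCommGroup N₁] [Module A N₁] [AddCommGroup N₂] [Module A N₂]
  [AddCommGroup N₃] [Module A N₃] {f : N₁ →ₗ[A] N₂} {g : N₂ →ₗ[A] N₃}
  (W : Type u) [AddCommGroup W] [Module A W]

/-- The group `Ext_A^i(N, W)` vanishes. -/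
abbrev ExtVanishes (A : Type u) [Ring A] (N W : Type u) [AddCommGroup N] [Module A N]
    [AddCommGroup W] [Module A W] (i : ℕ) : Prop :=
  Subsingleton (Abelian.Ext (ModuleCat.of A N) (ModuleCat.of A W) i)

theorem shortExact_moduleCat (hf : Function.Injective f) (h : Function.Exact f g)
    (hg : Function.Surjective g) :
    (ModuleCat.shortComplexOfCompEqZero f g h.linearMap_comp_eq_zero).ShortExact :=
  ModuleCat.shortComplex_shortExact _ h hf hg

theorem extVanishes_middle (hf : Function.Injective f) (h : Function.Exact f g)
    (hg : Function.Surjective g) {i : ℕ} (h₁ : ExtVanishes A N₁ W i)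
    (h₃ : ExtVanishes A N₃ W i) : ExtVanishes A N₂ W i := by
  refine subsingleton_of_forall_eq 0 fun x => ?_
  obtain ⟨y, rfl⟩ := Abelian.Ext.contravariant_sequence_exact₂
    (shortExact_moduleCat hf h hg) _ x (h₁.elim _ _)
  rw [h₃.elim y 0, Abelian.Ext.comp_zero]

theorem extVanishes_left (hf : Function.Injective f) (h : Function.Exact f g)
    (hg : Function.Surjective g) {i : ℕ} (h₂ : ExtVanishes A N₂ W i)
    (h₃ : ExtVanishes A N₃ W (i + 1)) : ExtVanishes A N₁ W i := by
  refine subsingleton_of_forall_eq 0 fun x => ?_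
  obtain ⟨y, rfl⟩ := Abelian.Ext.contravariant_sequence_exact₁
    (shortExact_moduleCat hf h hg) _ x (add_comm 1 i) (h₃.elim _ _)
  rw [h₂.elim y 0, Abelian.Ext.comp_zero]

theorem extVanishes_right (hf : Function.Injective f) (h : Function.Exact f g)
    (hg : Function.Surjective g) {i : ℕ} (h₁ : ExtVanishes A N₁ W i)
    (h₂ : ExtVanishes A N₂ W (i + 1)) : ExtVanishes A N₃ W (i + 1) := by
  refine subsingleton_of_forall_eq 0 fun x => ?_
  obtain ⟨y, rfl⟩ := Abelian.Ext.contravariant_sequence_exact₃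
    (shortExact_moduleCat hf h hg) _ x (h₂.elim _ _) (add_comm 1 i)
  rw [h₁.elim y 0, Abelian.Ext.comp_zero]

theorem extVanishes_middle_covariant (hf : Function.Injective f) (h : Function.Exact f g)
    (hg : Function.Surjective g) {i : ℕ} (h₁ : ExtVanishes A W N₁ i)
    (h₃ : ExtVanishes A W N₃ i) : ExtVanishes A W N₂ i := by
  refine subsingleton_of_forall_eq 0 fun x => ?_
  obtain ⟨y, rfl⟩ := Abelian.Ext.covariant_sequence_exact₂ _
    (shortExact_moduleCat hf h hg) x (h₃.elim _ _)
  rw [h₁.elim y 0, Abelian.Ext.zero_comp]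

theorem extVanishes_right_covariant (hf : Function.Injective f) (h : Function.Exact f g)
    (hg : Function.Surjective g) {i : ℕ} (h₁ : ExtVanishes A W N₁ (i + 1))
    (h₂ : ExtVanishes A W N₂ i) : ExtVanishes A W N₃ i := by
  refine subsingleton_of_forall_eq 0 fun x => ?_
  obtain ⟨y, rfl⟩ := Abelian.Ext.covariant_sequence_exact₃ _
    (shortExact_moduleCat hf h hg) x rfl (h₁.elim _ _)
  rw [h₂.elim y 0, Abelian.Ext.zero_comp]

/-- If `Ext¹(N₃, W) = 0`, maps `N₁ → W` extend along `N₁ → N₂`. -/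
theorem exists_extension_of_extVanishes (hf : Function.Injective f) (h : Function.Exact f g)
    (hg : Function.Surjective g) (h₃ : ExtVanishes A N₃ W 1) (φ : N₁ →ₗ[A] W) :
    ∃ ψ : N₂ →ₗ[A] W, ψ ∘ₗ f = φ := by
  obtain ⟨y, hy⟩ := Abelian.Ext.contravariant_sequence_exact₁
    (shortExact_moduleCat hf h hg) _ (Abelian.Ext.mk₀ (ModuleCat.ofHom φ)) (add_zero 1)
    (h₃.elim _ _)
  obtain ⟨ψ, rfl⟩ := (Abelian.Ext.mk₀_bijective _ _).2 y
  rw [Abelian.Ext.mk₀_comp_mk₀] at hy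
  have := (Abelian.Ext.mk₀_bijective _ _).1 hy
  exact ⟨ψ.hom, congrArg ModuleCat.Hom.hom this⟩

/-- If `N₂` is projective and maps `N₁ → W` extend along `N₁ → N₂`, then `Ext¹(N₃, W) = 0`. -/
theorem extVanishes_one_of_exists_extension (hf : Function.Injective f)
    (h : Function.Exact f g) (hg : Function.Surjective g) [Module.Projective A N₂]
    (H : ∀ φ : N₁ →ₗ[A] W, ∃ ψ : N₂ →ₗ[A] W, ψ ∘ₗ f = φ) : ExtVanishes A N₃ W 1 := by
  refine subsingleton_of_forall_eq 0 fun x => ?_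
  have hS := shortExact_moduleCat hf h hg
  obtain ⟨y, rfl⟩ := Abelian.Ext.contravariant_sequence_exact₃ hS _ x
    (Abelian.Ext.eq_zero_of_projective (P := ModuleCat.of A N₂) _) (add_zero 1)
  obtain ⟨φ, rfl⟩ := (Abelian.Ext.mk₀_bijective _ _).2 y
  obtain ⟨ψ, hψ⟩ := H φ.hom
  have : φ = ModuleCat.ofHom f ≫ ModuleCat.ofHom ψ := ModuleCat.hom_ext hψ.symm
  rw [this, ← Abelian.Ext.mk₀_comp_mk₀]
  exact hS.extClass_comp_assoc (Abelian.Ext.mk₀ (ModuleCat.ofHom ψ))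

theorem extVanishes_of_projective (P : Type u) [AddCommGroup P] [Module A P]
    [Module.Projective A P] {i : ℕ} (hi : 0 < i) : ExtVanishes A P W i := by
  obtain ⟨i, rfl⟩ := Nat.exists_eq_succ_of_ne_zero hi.ne'
  exact subsingleton_of_forall_eq 0 fun x =>
    Abelian.Ext.eq_zero_of_projective (P := ModuleCat.of A P) x

theorem extVanishes_of_subsingleton_left (N : Type u) [AddCommGroup N] [Module A N]
    [Subsingleton N] (i : ℕ) : ExtVanishes A N W i := by
  refine subsingleton_of_forall_eq 0 fun x => ?_
  have : 𝟙 (ModuleCat.of A N) = 0 := by ext w; exact Subsingleton.elim (α := N) _ _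
  rw [← x.mk₀_id_comp, this, Abelian.Ext.mk₀_zero, Abelian.Ext.zero_comp]

theorem InAdd.extVanishes {M X : Type u} [AddCommGroup M] [Module A M] [AddCommGroup X]
    [Module A X] (hX : InAdd A M X) {i : ℕ} (hM : ExtVanishes A M W i) :
    ExtVanishes A X W i := by
  obtain ⟨n, s, r, hrs⟩ := hX
  refine subsingleton_of_forall_eq 0 fun x => ?_
  have hid : 𝟙 (ModuleCat.of A X) = ∑ k : Fin n,
      ModuleCat.ofHom (LinearMap.proj k ∘ₗ s) ≫
        ModuleCat.ofHom (r ∘ₗ LinearMap.single A (fun _ => M) k) := by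
    ext y
    have h := LinearMap.congr_fun hrs y
    simp only [LinearMap.comp_apply, LinearMap.id_apply] at h
    have h2 : s y = ∑ k, Pi.single k (s y k) := (Finset.univ_sum_single (s y)).symm
    rw [h2, map_sum] at h
    rw [ModuleCat.hom_sum]
    simp only [LinearMap.sum_apply]
    exact h.symm
  rw [← x.mk₀_id_comp, hid, Abelian.Ext.mk₀_sum, Abelian.Ext.sum_comp]
  refine Finset.sum_eq_zero fun k _ => ?_
  rw [← Abelian.Ext.mk₀_comp_mk₀, Abelian.Ext.comp_assoc_of_second_deg_zero,
    hM.elim (Abelian.Ext.comp _ x _) 0, Abelian.Ext.comp_zero]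

end ExtModules

section Nakayama

variable {R : Type u} [CommRing R] [IsNoetherianRing R] [IsLocalRing R]
  {M : Type u} [AddCommGroup M] [Module R M] [Module.Finite R M]
  {W : Type u} [AddCommGroup W] [Module R W] [Module.Finite R W]

/-- If `x` is `M`-regular and `Ext^{i+1}(M/xM, W) = 0`, then `Ext^i(M, W) = 0`. -/
theorem extVanishes_of_quotSMulTop {x : R} (hx : x ∈ IsLocalRing.maximalIdeal R)
    (hreg : IsSMulRegular M x) {i : ℕ} (h : ExtVanishes R (QuotSMulTop x M) W (i + 1)) :
    ExtVanishes R M W i := by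
  have hS := IsSMulRegular.smulShortComplex_shortExact (M := ModuleCat.of R M) hreg
  by_contra hn
  rw [ExtVanishes, not_subsingleton_iff_nontrivial] at hn
  have hmem : x ∈ (Module.annihilator R (Abelian.Ext (ModuleCat.of R M)
      (ModuleCat.of R W) i)).jacobson := IsLocalRing.maximalIdeal_le_jacobson _ hx
  have : Module.Finite R (ModuleCat.of R M) := ‹Module.Finite R M›
  have : Module.Finite R (ModuleCat.of R W) := ‹Module.Finite R W›
  refine Submodule.top_ne_pointwise_smul_of_mem_jacobson_annihilator hmem ?_
  rw [eq_comm, eq_top_iff]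
  intro y _
  obtain ⟨z, hz⟩ : ∃ z : Abelian.Ext (ModuleCat.of R M) (ModuleCat.of R W) i,
      (Abelian.Ext.mk₀ (x • 𝟙 (ModuleCat.of R M))).comp z (zero_add i) = y :=
    Abelian.Ext.contravariant_sequence_exact₁ hS _ y (add_comm 1 i) (h.elim _ _)
  rw [Abelian.Ext.mk₀_smul, Abelian.Ext.smul_comp, Abelian.Ext.mk₀_id_comp] at hz
  rw [← hz]
  exact Submodule.smul_mem_pointwise_smul _ _ ⊤ trivial

theorem extVanishes_of_isWeaklyRegular {d : ℕ}
    (hW : ∀ i, d < i → ∀ (N : Type u) [AddCommGroup N] [Module R N] [Module.Finite R N],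
      ExtVanishes R N W i)
    (rs : List R) (hrs : ∀ r ∈ rs, r ∈ IsLocalRing.maximalIdeal R)
    (hreg : RingTheory.Sequence.IsWeaklyRegular M rs) {i : ℕ} (hi : d < i + rs.length) :
    ExtVanishes R M W i := by
  induction rs generalizing M i with
  | nil => exact hW i hi M
  | cons x rs ih =>
    rw [RingTheory.Sequence.isWeaklyRegular_cons_iff] at hreg
    refine extVanishes_of_quotSMulTop (hrs x (by simp)) hreg.1 ?_
    refine ih (fun r hr => hrs r (by simp [hr])) hreg.2 ?_
    simp only [List.length_cons] at hi
    omega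

end Nakayama

section CohenMacaulay

variable {R : Type u} [CommRing R] [IsLocalRing R]

theorem exists_isWeaklyRegular_of_le_moduleDepth {M : Type u} [AddCommGroup M] [Module R M]
    {d : ℕ} (hd : (d : ℕ∞) ≤ moduleDepth R M) :
    ∃ rs : List R, (∀ r ∈ rs, r ∈ IsLocalRing.maximalIdeal R) ∧
      RingTheory.Sequence.IsWeaklyRegular M rs ∧ d ≤ rs.length := by
  by_contra! h
  cases d with
  | zero => exact absurd (h [] (by simp) (RingTheory.Sequence.IsWeaklyRegular.nil R M)) (by simp)
  | succ d =>
    have : moduleDepth R M ≤ d := iSup₂_le fun rs hrs => by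
      exact_mod_cast Nat.lt_succ_iff.1 (h rs hrs.1 hrs.2)
    exact absurd (hd.trans this) (by exact_mod_cast (Nat.lt_succ_self d).not_ge)

theorem IsMCM.subsingleton_or_moduleDepth_eq {M : Type u} [AddCommGroup M] [Module R M]
    (hM : IsMCM R M) {d : ℕ} (hd : ringKrullDim R = d) :
    Subsingleton M ∨ moduleDepth R M = d := by
  refine hM.depth_eq.imp_right fun h => ?_
  have := (h.1.trans h.2).trans hd
  exact_mod_cast this

variable [IsNoetherianRing R]

/-- Over a local ring, a simple module embeds into every finitely generated module of depth
zero. -/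
theorem exists_injective_of_forall_not_isSMulRegular {N C : Type u} [AddCommGroup N] [Module R N]
    [AddCommGroup C] [Module R C] [Module.Finite R C] [IsSimpleModule R N]
    (hC : ∀ x ∈ IsLocalRing.maximalIdeal R, ¬ IsSMulRegular C x) :
    ∃ f : N →ₗ[R] C, Function.Injective f := by
  have : Module.Finite R N := inferInstance
  have hne : ¬ Subsingleton (N →ₗ[R] C) := by
    rw [IsSMulRegular.subsingleton_linearMap_iff]
    rintro ⟨r, hr, hreg⟩
    have := IsSimpleModule.nontrivial R N
    refine hC r (IsLocalRing.le_maximalIdeal ?_ hr) hreg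
    rwa [Ne, Module.annihilator_eq_top_iff, not_subsingleton_iff_nontrivial]
  rw [not_subsingleton_iff_nontrivial] at hne
  obtain ⟨f, hf⟩ := exists_ne (0 : N →ₗ[R] C)
  exact ⟨f, (LinearMap.injective_or_eq_zero f).resolve_right hf⟩

/-- Over a local ring of depth `d`, a finitely generated module of finite injective dimension has
injective dimension at most `d`, as far as finitely generated first arguments are concerned. -/
theorem extVanishes_of_moduleDepth_lt {W : Type u} [AddCommGroup W] [Module R W]
    [Module.Finite R W] (hW : ∃ n : ℕ, HasInjectiveDimensionLE (ModuleCat.of R W) n)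
    {d : ℕ} (hd : moduleDepth R R = d) {i : ℕ} (hi : d < i)
    (N : Type u) [AddCommGroup N] [Module R N] [Module.Finite R N] : ExtVanishes R N W i := by
  obtain ⟨n, hn⟩ := hW
  obtain ⟨rs, hrs, hreg, hlen⟩ := exists_isWeaklyRegular_of_le_moduleDepth hd.ge
  have hle : ∀ ss : List R, (∀ r ∈ ss, r ∈ IsLocalRing.maximalIdeal R) →
      RingTheory.Sequence.IsWeaklyRegular R ss → ss.length ≤ d := fun ss h₁ h₂ => by
    have : (ss.length : ℕ∞) ≤ moduleDepth R R :=
      le_iSup₂_of_le (f := fun (rs : List R) (_ : (∀ r ∈ rs, r ∈ IsLocalRing.maximalIdeal R) ∧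
        RingTheory.Sequence.IsWeaklyRegular R rs) => (rs.length : ℕ∞)) ss ⟨h₁, h₂⟩ le_rfl
    rw [hd] at this
    exact_mod_cast this
  let C := R ⧸ (Ideal.ofList rs • (⊤ : Submodule R R))
  have hC : ∀ x ∈ IsLocalRing.maximalIdeal R, ¬ IsSMulRegular C x := fun x hx hxC => by
    have := hle (rs ++ [x]) (by simpa [or_imp, forall_and] using ⟨hrs, hx⟩)
      ((RingTheory.Sequence.isWeaklyRegular_append_iff R rs [x]).2
        ⟨hreg, (RingTheory.Sequence.isWeaklyRegular_singleton_iff _ x).2 hxC⟩)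
    simp only [List.length_append, List.length_singleton] at this
    omega
  have hCext : ∀ j, d < j → ExtVanishes R C W j := fun j hj => by
    have hpd : projectiveDimension (ModuleCat.of R C) ≤ d := by
      refine (ModuleCat.projectiveDimension_quotient_eq_add_length_of_isWeaklyRegular
        (ModuleCat.of R R) rs hreg hrs).trans_le ?_
      rw [ModuleCat.projectiveDimension_eq_zero_of_projective, zero_add]
      exact_mod_cast hle rs hrs hreg
    rw [projectiveDimension_le_iff] at hpd
    exact HasProjectiveDimensionLT.subsingleton _ (d + 1) j hj _
  suffices H : ∀ k i, d < i → n < i + k → ∀ (N : Type u) [AddCommGroup N] [Module R N]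
      [Module.Finite R N], ExtVanishes R N W i from H (n + 1) i hi (by omega) N
  intro k
  induction k with
  | zero =>
    intro i _ hni N _ _ _
    exact HasInjectiveDimensionLT.subsingleton _ (n + 1) i hni _
  | succ k ih =>
    intro i hdi hni N _ _ hN
    have ih' := ih (i + 1) (by omega) (by omega)
    induction hN using IsNoetherianRing.induction_on_isQuotientEquivQuotientPrime R with
    | subsingleton N => exact extVanishes_of_subsingleton_left W N i
    | exact N₁ N₂ N₃ f g hf hg hfg h₁ h₃ => exact extVanishes_middle W hf hfg hg h₁ h₃
    | quotient N p e =>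
      by_cases hp : p.1 = IsLocalRing.maximalIdeal R
      · have : p.1.IsMaximal := hp ▸ inferInstance
        have : IsSimpleModule R (R ⧸ p.1) := isSimpleModule_iff_isCoatom.2 this.out
        have : IsSimpleModule R N := IsSimpleModule.congr e
        obtain ⟨f, hf⟩ := exists_injective_of_forall_not_isSMulRegular (N := N) hC
        exact extVanishes_left W hf (LinearMap.exact_map_mkQ_range f)
          (Submodule.mkQ_surjective _) (hCext i hdi) (ih' _)
      · obtain ⟨x, hx, hxp⟩ := SetLike.exists_of_lt
          (lt_of_le_of_ne (IsLocalRing.le_maximalIdeal p.2.ne_top) hp)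
        refine extVanishes_of_quotSMulTop hx ?_ (ih' _)
        rw [e.isSMulRegular_congr, isSMulRegular_iff_right_eq_zero_of_smul]
        intro y hy
        obtain ⟨y, rfl⟩ := Ideal.Quotient.mk_surjective y
        change Ideal.Quotient.mk p.1 (x * y) = 0 at hy
        rw [Ideal.Quotient.eq_zero_iff_mem] at hy ⊢
        exact (p.2.mem_or_mem hy).resolve_left hxp

/-- Maximal Cohen-Macaulay modules have no higher extensions by a canonical module. -/
theorem IsMCM.extVanishes {M W : Type u} [AddCommGroup M] [Module R M] [AddCommGroup W]
    [Module R W] (hM : IsMCM R M) (hR : IsMCM R R) (hW : IsCanonicalModule R W) {i : ℕ}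
    (hi : 0 < i) : ExtVanishes R M W i := by
  obtain ⟨d, hd, -⟩ := hW.ext_residueField
  have := hM.finite
  have := hW.isMCM.finite
  obtain h | h := hM.subsingleton_or_moduleDepth_eq hd
  · exact extVanishes_of_subsingleton_left W M i
  · obtain ⟨rs, hrs, hreg, hlen⟩ := exists_isWeaklyRegular_of_le_moduleDepth h.ge
    refine extVanishes_of_isWeaklyRegular (d := d) (fun i hi N _ _ _ => ?_) rs hrs hreg (by omega)
    refine extVanishes_of_moduleDepth_lt hW.finite_injectiveDimension ?_ hi N
    exact (hR.subsingleton_or_moduleDepth_eq hd).resolve_left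
      (not_subsingleton_iff_nontrivial.2 inferInstance)

end CohenMacaulay

section Coresolution

variable {R : Type u} [CommRing R] {W : Type u} [AddCommGroup W] [Module R W]

/-- The dual by `W` of a finitely generated module without higher extensions by `W` has itself no
higher extensions by `W`. -/
theorem extVanishes_linearMap [IsNoetherianRing R] {n : ℕ}
    (hn : ∀ i, n < i → ∀ (N : Type u) [AddCommGroup N] [Module R N], ExtVanishes R N W i)
    (hWW : ∀ i, 0 < i → ExtVanishes R W W i)
    (M : Type u) [AddCommGroup M] [Module R M] [Module.Finite R M]
    (hM : ∀ i, 0 < i → ExtVanishes R M W i) {i : ℕ} (hi : 0 < i) :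
    ExtVanishes R (M →ₗ[R] W) W i := by
  suffices H : ∀ k i, 0 < i → n < i + k → ∀ (M : Type u) [AddCommGroup M] [Module R M]
      [Module.Finite R M], (∀ i, 0 < i → ExtVanishes R M W i) →
      ExtVanishes R (M →ₗ[R] W) W i from H (n + 1) i hi (by omega) M hM
  intro k
  induction k with
  | zero => exact fun i _ h M _ _ _ _ => hn i h _
  | succ k ih =>
    intro i hi hni M _ _ _ hM
    obtain ⟨m, f, hf⟩ := Module.Finite.exists_fin' R M
    have hex : Function.Exact (LinearMap.ker f).subtype f := LinearMap.exact_subtype_ker_map f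
    have hinj : Function.Injective (LinearMap.ker f).subtype := Subtype.val_injective
    have hK : ∀ j, 0 < j → ExtVanishes R (LinearMap.ker f) W j := fun j hj =>
      extVanishes_left W hinj hex hf (extVanishes_of_projective W _ hj) (hM _ (by omega))
    have hF : InAdd R W ((Fin m → R) →ₗ[R] W) :=
      let e := (LinearMap.lsum R (fun _ : Fin m => R) R (M := W)).symm.trans
        (LinearEquiv.piCongrRight fun _ : Fin m => LinearMap.ringLmapEquivSelf R R W)
      ⟨m, e.toLinearMap, e.symm.toLinearMap, by ext1 x; simp⟩
    exact extVanishes_left W (LinearMap.lcomp_injective_of_surjective f hf)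
      (LinearMap.exact_lcomp_of_exact_of_surjective W hex hf)
      (fun φ => exists_extension_of_extVanishes W hinj hex hf (hM 1 one_pos) φ)
      (hF.extVanishes W (hWW i hi)) (ih (i + 1) (by omega) (by omega) _ hK)

/-- In an exact sequence of modules without higher extensions by a module `W` of finite injective
dimension, the images have no higher extensions by `W` either. -/
theorem extVanishes_range {n : ℕ}
    (hn : ∀ i, n < i → ∀ (N : Type u) [AddCommGroup N] [Module R N], ExtVanishes R N W i)
    {I : ℕ → Type u} [∀ j, AddCommGroup (I j)] [∀ j, Module R (I j)]
    (d : ∀ j, I j →ₗ[R] I (j + 1)) (hd : ∀ j, Function.Exact (d j) (d (j + 1)))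
    (hI : ∀ j i, 0 < i → ExtVanishes R (I j) W i) (j : ℕ) {i : ℕ} (hi : 0 < i) :
    ExtVanishes R (LinearMap.range (d j)) W i := by
  suffices H : ∀ k i, 0 < i → n < i + k → ∀ j, ExtVanishes R (LinearMap.range (d j)) W i from
    H (n + 1) i hi (by omega) j
  intro k
  induction k with
  | zero => exact fun i _ h j => hn i h _
  | succ k ih =>
    intro i hi hni j
    refine extVanishes_left W (f := (LinearMap.range (d j)).subtype)
      (g := (d (j + 1)).rangeRestrict) Subtype.val_injective (fun x => ?_)
      (LinearMap.surjective_rangeRestrict _) (hI _ i hi) (ih (i + 1) (by omega) (by omega) (j + 1))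
    rw [Submodule.coe_subtype, Subtype.range_coe, ← hd j |>.linearMap_ker_eq, SetLike.mem_coe, LinearMap.mem_ker,
      ← Subtype.coe_inj]
    rfl

end Coresolution

section InAdd

variable {A : Type u} [Ring A] {L M X : Type u} [AddCommGroup L] [Module A L] [AddCommGroup M]
  [Module A M] [AddCommGroup X] [Module A X]

theorem InAdd.of_retract (s : X →ₗ[A] M) (r : M →ₗ[A] X) (h : r ∘ₗ s = LinearMap.id) :
    InAdd A M X :=
  ⟨1, LinearMap.pi fun _ => s, r ∘ₗ LinearMap.proj 0, h⟩

theorem InAdd.refl : InAdd A M M :=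
  InAdd.of_retract LinearMap.id LinearMap.id rfl

theorem InAdd.of_summand (hX : InAdd A L X) (s : L →ₗ[A] M) (r : M →ₗ[A] L)
    (h : r ∘ₗ s = LinearMap.id) : InAdd A M X := by
  obtain ⟨n, s', r', h'⟩ := hX
  refine ⟨n, s.compLeft (Fin n) ∘ₗ s', r' ∘ₗ r.compLeft (Fin n), LinearMap.ext fun x => ?_⟩
  have : r.compLeft (Fin n) (s.compLeft (Fin n) (s' x)) = s' x :=
    funext fun k => LinearMap.congr_fun h (s' x k)
  simp only [LinearMap.comp_apply, this]
  exact LinearMap.congr_fun h' x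

theorem InAdd.finite [Module.Finite A M] (h : InAdd A M X) : Module.Finite A X := by
  obtain ⟨n, s, r, h⟩ := h
  exact Module.Finite.of_surjective r fun x => ⟨s x, LinearMap.congr_fun h x⟩

theorem InAdd.projective [Module.Projective A M] (h : InAdd A M X) : Module.Projective A X := by
  obtain ⟨n, s, r, h⟩ := h
  have : Module.Projective A (Fin n → M) :=
    Module.Projective.of_equiv (DFinsupp.linearEquivFunOnFintype (R := A) (M := fun _ : Fin n => M))
  exact Module.Projective.of_split s r h

theorem inAdd_of_projective_of_finite [Module.Projective A X] [Module.Finite A X] :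
    InAdd A A X := by
  obtain ⟨n, r, hr⟩ := Module.Finite.exists_fin' A X
  obtain ⟨s, hs⟩ := Module.projective_lifting_property r LinearMap.id hr
  exact ⟨n, s, r, hs⟩

/-- If all maps to `M` extend along `f`, then so do all maps to modules in `add M`. -/
theorem InAdd.exists_extension {N₁ N₂ : Type u} [AddCommGroup N₁] [Module A N₁]
    [AddCommGroup N₂] [Module A N₂] {f : N₁ →ₗ[A] N₂} (hX : InAdd A M X)
    (H : ∀ φ : N₁ →ₗ[A] M, ∃ ψ : N₂ →ₗ[A] M, ψ ∘ₗ f = φ) (φ : N₁ →ₗ[A] X) :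
    ∃ ψ : N₂ →ₗ[A] X, ψ ∘ₗ f = φ := by
  obtain ⟨n, s, r, h⟩ := hX
  choose ψ hψ using fun k : Fin n => H (LinearMap.proj k ∘ₗ s ∘ₗ φ)
  refine ⟨r ∘ₗ LinearMap.pi ψ, LinearMap.ext fun x => ?_⟩
  have : LinearMap.pi ψ (f x) = s (φ x) := funext fun k => LinearMap.congr_fun (hψ k) x
  simp only [LinearMap.comp_apply, this]
  exact LinearMap.congr_fun h (φ x)

theorem InAdd.restrictScalars (R : Type u) [CommRing R] [Algebra R A] [Module R M]
    [IsScalarTower R A M] [Module R X] [IsScalarTower R A X] (h : InAdd A M X) : InAdd R M X := by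
  obtain ⟨n, s, r, h⟩ := h
  exact ⟨n, s.restrictScalars R, r.restrictScalars R,
    LinearMap.ext fun x => LinearMap.congr_fun h x⟩

end InAdd

namespace OrderCanonical

variable (R A W : Type u) [CommRing R] [Ring A] [Algebra R A] [AddCommGroup W] [Module R W]

noncomputable instance : Module R (OrderCanonical R A W) :=
  inferInstanceAs (Module R (A →ₗ[R] W))

instance : IsScalarTower R A (OrderCanonical R A W) where
  smul_assoc r a f := LinearMap.ext fun x =>
    (congrArg (show A →ₗ[R] W from f) (mul_smul_comm r x a)).trans
      (map_smul (show A →ₗ[R] W from f) r (x * a))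

theorem finite [IsNoetherianRing R] [Module.Finite R A] [Module.Finite R W] :
    Module.Finite A (OrderCanonical R A W) := by
  have : Module.Finite R (OrderCanonical R A W) :=
    inferInstanceAs (Module.Finite R (A →ₗ[R] W))
  exact Module.Finite.of_restrictScalars_finite R A _

variable {R A W}

/-- If all `R`-linear maps to `W` extend along the `A`-linear map `f`, then so do all `A`-linear
maps to `Hom_R(A, W)`. -/
theorem exists_extension {N₁ N₂ : Type u} [AddCommGroup N₁] [Module A N₁] [Module R N₁]
    [IsScalarTower R A N₁] [AddCommGroup N₂] [Module A N₂] [Module R N₂] [IsScalarTower R A N₂]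
    {f : N₁ →ₗ[A] N₂}
    (H : ∀ φ : N₁ →ₗ[R] W, ∃ ψ : N₂ →ₗ[R] W, ψ ∘ₗ f.restrictScalars R = φ)
    (φ : N₁ →ₗ[A] OrderCanonical R A W) :
    ∃ ψ : N₂ →ₗ[A] OrderCanonical R A W, ψ ∘ₗ f = φ := by
  let ev : OrderCanonical R A W →ₗ[R] W := LinearMap.applyₗ (R := R) (1 : A)
  obtain ⟨ψ, hψ⟩ := H (ev ∘ₗ φ.restrictScalars R)
  refine ⟨{ toFun := fun y => show A →ₗ[R] W from ψ ∘ₗ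
              (LinearMap.toSpanSingleton A N₂ y).restrictScalars R
            map_add' := fun y z => LinearMap.ext fun a => ?_
            map_smul' := fun b y => LinearMap.ext fun a => ?_ },
    LinearMap.ext fun x => LinearMap.ext fun a => ?_⟩
  · change ψ (a • (y + z)) = ψ (a • y) + ψ (a • z)
    rw [smul_add, map_add]
  · change ψ (a • b • y) = ψ ((a * b) • y)
    rw [mul_smul]
  · change ψ (a • f x) = (show A →ₗ[R] W from φ x) a
    rw [← map_smul]
    refine (LinearMap.congr_fun hψ (a • x)).trans ?_
    change (show A →ₗ[R] W from φ (a • x)) 1 = _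
    rw [map_smul]
    exact congrArg (show A →ₗ[R] W from φ x) (one_mul a)

end OrderCanonical

section Tilting

variable {A : Type u} [Ring A] {P₀ P : Type u} [AddCommGroup P₀] [Module A P₀] [AddCommGroup P]
  [Module A P]

/-- If `A` embeds into the projective module `P₀` in `add P` with cokernel `K`, where `P` is
projective and all maps `A → Y` with `Y ∈ add P` extend to `P₀`, then `K ⊕ P` is tilting. -/
theorem isTilting_cokernel_prod (hP : InAdd A A P) (hP₀ : InAdd A P P₀) (f : A →ₗ[A] P₀)
    (hf : Function.Injective f)
    (H : ∀ φ : A →ₗ[A] P, ∃ ψ : P₀ →ₗ[A] P, ψ ∘ₗ f = φ) :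
    IsTilting A ((P₀ ⧸ LinearMap.range f) × P) := by
  have := hP.finite
  have := hP.projective
  have := hP₀.finite
  have := hP₀.projective
  have hex : Function.Exact f (LinearMap.range f).mkQ := LinearMap.exact_map_mkQ_range f
  have hsurj := (LinearMap.range f).mkQ_surjective
  have hinl : Function.Injective (LinearMap.inl A (P₀ ⧸ LinearMap.range f) P) :=
    LinearMap.inl_injective
  have hsnd : Function.Surjective (LinearMap.snd A (P₀ ⧸ LinearMap.range f) P) :=
    LinearMap.snd_surjective
  have hprod : Function.Exact (LinearMap.inl A (P₀ ⧸ LinearMap.range f) P)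
    (LinearMap.snd A (P₀ ⧸ LinearMap.range f) P) := Function.Exact.inl_snd
  have hpdK : ∀ i, 1 < i → ∀ (Y : Type u) [AddCommGroup Y] [Module A Y],
      ExtVanishes A (P₀ ⧸ LinearMap.range f) Y i := fun i hi Y _ _ => by
    obtain ⟨i, rfl⟩ := Nat.exists_eq_add_of_lt hi
    exact extVanishes_right Y hf hex hsurj (extVanishes_of_projective Y A (by omega))
      (extVanishes_of_projective Y P₀ (by omega))
  have hpdT : ∀ i, 1 < i → ∀ (Y : Type u) [AddCommGroup Y] [Module A Y],
      ExtVanishes A ((P₀ ⧸ LinearMap.range f) × P) Y i := fun i hi Y _ _ =>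
    extVanishes_middle Y hinl hprod hsnd (hpdK i hi Y) (extVanishes_of_projective Y P (by omega))
  refine ⟨inferInstance, ?_, ?_, fun i hi => ?_⟩
  · exact HasProjectiveDimensionLT.mk fun i hi Y e => (hpdT i hi Y).elim _ _
  · refine ⟨P₀, P₀ ⧸ LinearMap.range f, _, _, _, _, f, (LinearMap.range f).mkQ, ?_, ?_, hf, hex,
      hsurj⟩
    · exact hP₀.of_summand (LinearMap.inr A _ P) (LinearMap.snd A _ P) (LinearMap.snd_comp_inr ..)
    · exact InAdd.of_retract (LinearMap.inl A _ P) (LinearMap.fst A _ P)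
        (LinearMap.fst_comp_inl ..)
  · obtain hi | rfl := lt_or_eq_of_le (Nat.succ_le_of_lt hi)
    · exact hpdT i hi _
    · have hKP := extVanishes_one_of_exists_extension P hf hex hsurj H
      have hKP₀ := extVanishes_one_of_exists_extension P₀ hf hex hsurj (hP₀.exists_extension H)
      have hKK := extVanishes_right_covariant (P₀ ⧸ LinearMap.range f) hf hex hsurj
        (hpdK 2 (by omega) A) hKP₀
      exact extVanishes_middle _ hinl hprod hsnd
        (extVanishes_middle_covariant _ hinl hprod hsnd hKK hKP)
        (extVanishes_of_projective _ P one_pos)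

end Tilting

section Order

variable {R W A : Type u} [CommRing R] [AddCommGroup W] [Module R W] [Ring A] [Algebra R A]

theorem IsQF3.exists_projective (h : IsQF3 R A W) :
    ∃ c : CMInjCoresolution R A W A, Module.Projective A (c.I 0) := by
  by_contra! hc
  have : cmDomDim R A W ≤ 0 := iSup₂_le fun c _ => iInf₂_le_of_le 0 (hc c) le_rfl
  exact absurd (h.trans this) (by simp)

/-- Maps from `A` to `Hom_R(A, W)` extend along the first map of a CM-injective coresolution. -/
theorem CMInjCoresolution.exists_extension [IsNoetherianRing R] [IsLocalRing R]
    (hR : IsMCM R R) (hW : IsCanonicalModule R W) (hA : IsMCM R A)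
    (c : CMInjCoresolution R A W A) (φ : A →ₗ[A] OrderCanonical R A W) :
    ∃ ψ : c.I 0 →ₗ[A] OrderCanonical R A W, ψ ∘ₗ c.ι = φ := by
  let : ∀ j, Module R (c.I j) := fun j => Module.compHom (c.I j) (algebraMap R A)
  have : ∀ j, IsScalarTower R A (c.I j) := fun j => IsScalarTower.of_algebraMap_smul fun _ _ => rfl
  obtain ⟨n, hn⟩ := hW.finite_injectiveDimension
  have hn' : ∀ i, n < i → ∀ (N : Type u) [AddCommGroup N] [Module R N], ExtVanishes R N W i :=
    fun i hi N _ _ => HasInjectiveDimensionLT.subsingleton _ (n + 1) i hi _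
  have := hA.finite
  have hω : ∀ i, 0 < i → ExtVanishes R (OrderCanonical R A W) W i := fun i hi =>
    extVanishes_linearMap hn' (fun i hi => hW.isMCM.extVanishes hR hW hi) A
      (fun i hi => hA.extVanishes hR hW hi) hi
  have hK := extVanishes_range hn' (fun j => (c.d j).restrictScalars R) c.exact_succ
    (fun j i hi => ((c.inAdd j).restrictScalars R).extVanishes W (hω i hi)) 0 one_pos
  refine OrderCanonical.exists_extension (fun φ => exists_extension_of_extVanishes W
    (f := c.ι.restrictScalars R) (g := ((c.d 0).restrictScalars R).rangeRestrict)
    c.injective (fun x => ?_) (LinearMap.surjective_rangeRestrict _) hK φ) φ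
  refine Iff.trans ?_ (c.exact_zero x)
  rw [← Subtype.coe_inj]
  rfl

end Order

theorem mainTheorem2
    (R : Type u) [CommRing R] [IsNoetherianRing R] [IsLocalRing R] (hR : IsMCM R R)
    (W : Type u) [AddCommGroup W] [Module R W] (hW : IsCanonicalModule R W)
    (Λ : Type u) [Ring Λ] [Algebra R Λ] (hΛ : IsMCM R Λ) (hsemi : IsSemiperfect Λ)
    (hQF3 : IsQF3 R Λ W)
    (Pi : Type u) [AddCommGroup Pi] [Module Λ Pi] (hPi : IsCMProjInjGenerator R Λ W Pi) :
    (∃ c : CMInjCoresolution R Λ W Λ, InAdd Λ Pi (c.I 0)) ∧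
      ∀ c : CMInjCoresolution R Λ W Λ, InAdd Λ Pi (c.I 0) →
        IsTilting Λ ((c.I 0 ⧸ LinearMap.range c.ι) × Pi) := by
  have := hΛ.finite
  have := hW.isMCM.finite
  have := OrderCanonical.finite R Λ W
  obtain ⟨hPiΛ, hPiω⟩ := (hPi Pi).1 InAdd.refl
  refine ⟨?_, fun c hc => isTilting_cokernel_prod hPiΛ hc c.ι c.injective
    (hPiω.exists_extension (c.exists_extension hR hW hΛ))⟩
  obtain ⟨c, hc⟩ := hQF3.exists_projective
  have := (c.inAdd 0).finite
  exact ⟨c, (hPi (c.I 0)).2 ⟨inAdd_of_projective_of_finite, c.inAdd 0⟩⟩
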